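/- Let $H$ be a complex separable Hilbert space and, for $X\in B(H)$ and $t\ge 0$, let $\mu(t,X)=\inf\{\|XP\| : P \text{ an orthogonal projection},\ \operatorname{Tr}(1-P)\le t\}$ (so $\mu(k,X)$, $k=0,1,2,\dots$, are the singular values of $X$). Let $g:(0,\infty)\to(0,\infty)$ be bounded and decreasing (not necessarily strictly), regularly varying of index $-1$ at infinity, i.e. $\lim_{t\to\infty} g(ct)/g(t)=1/c$ for every $c>0$ (in particular $g(t)/g(2t)\to 2$), and not integrable on $(0,\infty)$; it follows that $g(t)\to0$ as $t\to\infty$ and $\sup_{t>0}g(t)/g(2t)<\infty$. Put $G(t)=\int_0^t g(s)\,ds$ and $$\mathcal L_g(H)=\Big\{X\in B(H): \sup_{t>0}\frac{\mu(t,X)}{g(t)}<\infty\Big\},$$ which is a linear space. A symmetric functional on $\mathcal L_g(H)$ is a linear functional $\phi:\mathcal L_g(H)\to\mathbb C$ with $\phi(X)=\phi(Y)$ whenever $0\le X,Y\in\mathcal L_g(H)$ and $\mu(\cdot,X)=\mu(\cdot,Y)$. Let $\ell_\infty$ be the space of bounded complex sequences $(x_n)_{n\ge0}$. An extended limit is a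 bounded linear functional $\omega$ on $\ell_\infty$ with $\omega(x)=\lim_{n\to\infty} x_n$ for every convergent $x$. For $x\in\ell_\infty$, $X\in\mathcal L_g(H)$ and $n\ge 0$ put $$(C_gx)_n=\frac{\sum_{m=0}^n 2^mg(2^m)x_m}{\sum_{m=0}^n2^mg(2^m)},\qquad \Phi_g(X)_n=\frac1{2^ng(2^n)}\int_{2^n}^{2^{n+1}}\mu(s,X)\,ds .$$ Then $C_gx\in\ell_\infty$ and $\Phi_g(X)\in\ell_\infty$. A symmetric functional $\phi$ on $\mathcal L_g(H)$ is called a Dixmier trace if there is an extended limit $\omega$ such that $$\phi(X)=\log 2\cdot\omega\Big(n\mapsto \frac{\sum_{k=0}^n\mu(k,X)}{G(n)}\Big)\qquad\text{for all } 0\le X\in\mathcal L_g(H)$$ (the sequence is bounded over $n\ge1$; its term at $n=0$ is immaterial and is taken to be $0$). Theorem. A symmetric functional $\phi$ on $\mathcal L_g(H)$ is a Dixmier trace if and only if there is an extended limit $\gamma$ such that $$\phi(X)=\gamma\big(C_g(\Phi_g(X))\big)\qquad\text{for all } 0\le X\in\mathcal L_g(H).$$ The same equivalence holds when, in the definition of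 a Dixmier trace and in the formula alike, only positive extended limits are admitted ($\omega(x)\ge0$ whenever all $x_n\ge0$). -/

import Mathlib

open Filter Topology MeasureTheory Set
open scoped ENNReal ComplexOrder

noncomputable section

namespace DixmierTheory

/-! ### Generalised singular values of bounded operators -/

section SingularValues

variable {H : Type*} [NormedAddCommGroup H] [InnerProductSpace ℂ H] [CompleteSpace H]

/-- The norms `‖X P‖`, where `P` is an orthogonal projection with `Tr (1 - P) ≤ t`.
The standard trace of the projection `1 - P` is the dimension of its range. -/
def cutoffNorms (t : ℝ) (X : H →L[ℂ] H) : Set ℝ :=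
  {r | ∃ P : H →L[ℂ] H, IsStarProjection P ∧
    FiniteDimensional ℂ (1 - P : H →L[ℂ] H).range ∧
    (Module.finrank ℂ (1 - P : H →L[ℂ] H).range : ℝ) ≤ t ∧ r = ‖X * P‖}

/-- The generalised singular value function `μ(t, X)` of `X ∈ B(H)`, for `t ≥ 0`
(with respect to the standard trace): the infimum of `‖X P‖` over the orthogonal projections `P`
with `Tr (1 - P) ≤ t`. For a natural number `k`, `μ(k, X)` is the `k`-th singular value,
counted from `0`. -/
def singVal (t : ℝ) (X : H →L[ℂ] H) : ℝ :=
  sInf (cutoffNorms t X)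

lemma cutoffNorms_bddBelow (t : ℝ) (X : H →L[ℂ] H) : BddBelow (cutoffNorms t X) := by
  refine ⟨0, ?_⟩
  rintro r ⟨P, -, -, -, rfl⟩
  exact norm_nonneg _

lemma norm_mem_cutoffNorms {t : ℝ} (ht : 0 ≤ t) (X : H →L[ℂ] H) : ‖X‖ ∈ cutoffNorms t X := by
  have h : (1 - 1 : H →L[ℂ] H).range = ⊥ := by
    rw [sub_self]
    exact LinearMap.range_zero
  refine ⟨1, IsStarProjection.one _, ?_, ?_, by simp⟩
  · rw [h]; infer_instance
  · rw [h]; simpa using ht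

lemma singVal_nonneg (t : ℝ) (X : H →L[ℂ] H) : 0 ≤ singVal t X := by
  apply Real.sInf_nonneg
  rintro r ⟨P, -, -, -, rfl⟩
  exact norm_nonneg _

lemma singVal_antitoneOn (X : H →L[ℂ] H) : AntitoneOn (fun t => singVal t X) (Ici 0) := by
  intro s hs t _ hst
  refine csInf_le_csInf (cutoffNorms_bddBelow t X) ⟨_, norm_mem_cutoffNorms hs X⟩ ?_
  rintro r ⟨P, h1, h2, h3, h4⟩
  exact ⟨P, h1, h2, h3.trans hst, h4⟩

lemma singVal_smul_le {t : ℝ} (ht : 0 ≤ t) (c : ℂ) (X : H →L[ℂ] H) :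
    singVal t (c • X) ≤ ‖c‖ * singVal t X := by
  have key : ∀ r ∈ cutoffNorms t X, singVal t (c • X) ≤ ‖c‖ * r := by
    rintro r ⟨P, h1, h2, h3, rfl⟩
    refine csInf_le (cutoffNorms_bddBelow _ _) ⟨P, h1, h2, h3, ?_⟩
    rw [smul_mul_assoc, norm_smul]
  have hne : (cutoffNorms t X).Nonempty := ⟨_, norm_mem_cutoffNorms ht X⟩
  rcases eq_or_lt_of_le (norm_nonneg c) with hc | hc
  · have := key _ (norm_mem_cutoffNorms ht X)
    rw [← hc] at this ⊢
    simpa using this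
  · rw [← div_le_iff₀' hc]
    refine le_csInf hne fun r hr => ?_
    rw [div_le_iff₀' hc]
    exact key r hr

lemma singVal_add_le {s t : ℝ} (hs : 0 ≤ s) (ht : 0 ≤ t) (X Y : H →L[ℂ] H) :
    singVal (s + t) (X + Y) ≤ singVal s X + singVal t Y := by
  have key : ∀ a ∈ cutoffNorms s X, ∀ b ∈ cutoffNorms t Y, singVal (s + t) (X + Y) ≤ a + b := by
    rintro a ⟨P, hP, hPf, hPr, rfl⟩ b ⟨Q, hQ, hQf, hQr, rfl⟩
    set K : Submodule ℂ H := (1 - P : H →L[ℂ] H).range ⊔ (1 - Q : H →L[ℂ] H).range with hK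
    have : FiniteDimensional ℂ K := inferInstance
    set R : H →L[ℂ] H := 1 - K.starProjection with hR
    have hRproj : IsStarProjection R := (isStarProjection_starProjection (U := K)).one_sub
    have h1R : (1 - R : H →L[ℂ] H).range = K := by
      rw [hR, sub_sub_cancel]
      exact Submodule.range_starProjection K
    have absorb : ∀ T : H →L[ℂ] H, IsStarProjection T → (1 - T : H →L[ℂ] H).range ≤ K →
        T * R = R := by
      intro T hT hle
      have h0 : R * (1 - T) = 0 := by
        ext v
        have hv : (1 - T) v ∈ K := hle ⟨v, rfl⟩
        have : K.starProjection ((1 - T) v) = (1 - T) v :=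
          Submodule.starProjection_eq_self_iff.2 hv
        change (1 - T) v - K.starProjection ((1 - T) v) = 0
        rw [this, sub_self]
      have h1 : (1 - T) * R = 0 := by
        have := congrArg star h0
        rwa [star_mul, star_zero, hRproj.isSelfAdjoint.star_eq,
          (hT.one_sub).isSelfAdjoint.star_eq] at this
      rw [sub_mul, one_mul, sub_eq_zero] at h1
      exact h1.symm
    have hRn : ‖R‖ ≤ 1 := by
      have := Submodule.starProjection_norm_le (Kᗮ)
      rwa [Submodule.starProjection_orthogonal'] at this
    have bound : ∀ (Z T : H →L[ℂ] H), T * R = R → ‖Z * R‖ ≤ ‖Z * T‖ := by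
      intro Z T hT
      calc ‖Z * R‖ = ‖Z * T * R‖ := by rw [mul_assoc, hT]
        _ ≤ ‖Z * T‖ * ‖R‖ := norm_mul_le _ _
        _ ≤ ‖Z * T‖ * 1 := by gcongr
        _ = ‖Z * T‖ := mul_one _
    have hmem : ‖(X + Y) * R‖ ∈ cutoffNorms (s + t) (X + Y) := by
      refine ⟨R, hRproj, by rw [h1R]; infer_instance, ?_, rfl⟩
      rw [h1R]
      have h := Submodule.finrank_add_le_finrank_add_finrank
        (1 - P : H →L[ℂ] H).range (1 - Q : H →L[ℂ] H).range
      have h' : (Module.finrank ℂ K : ℝ) ≤ Module.finrank ℂ (1 - P : H →L[ℂ] H).range +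
          Module.finrank ℂ (1 - Q : H →L[ℂ] H).range := by exact_mod_cast h
      linarith
    calc singVal (s + t) (X + Y) ≤ ‖(X + Y) * R‖ := csInf_le (cutoffNorms_bddBelow _ _) hmem
      _ ≤ ‖X * R‖ + ‖Y * R‖ := by rw [add_mul]; exact norm_add_le _ _
      _ ≤ ‖X * P‖ + ‖Y * Q‖ := add_le_add
          (bound X P (absorb P hP le_sup_left)) (bound Y Q (absorb Q hQ le_sup_right))
  have h1 : ∀ b ∈ cutoffNorms t Y, singVal (s + t) (X + Y) - b ≤ singVal s X := by
    intro b hb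
    refine le_csInf ⟨_, norm_mem_cutoffNorms hs X⟩ fun a ha => ?_
    linarith [key a ha b hb]
  have h2 : singVal (s + t) (X + Y) - singVal s X ≤ singVal t Y := by
    refine le_csInf ⟨_, norm_mem_cutoffNorms ht Y⟩ fun b hb => ?_
    linarith [h1 b hb]
  linarith

end SingularValues

/-! ### The simply generated ideals -/

/-- The standing assumptions on the generating function `g : (0, ∞) → (0, ∞)` (values of `g`
outside `(0, ∞)` are irrelevant): `g` is positive, decreasing, vanishes at infinity, and
`g(t) / g(2t)` is bounded. -/
structure IsGenerator (g : ℝ → ℝ) : Prop where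
  pos : ∀ t, 0 < t → 0 < g t
  antitone : AntitoneOn g (Ioi 0)
  tendsto_zero : Tendsto g atTop (𝓝 0)
  doubling : ∃ C : ℝ, ∀ t, 0 < t → g t / g (2 * t) ≤ C

/-- Regular variation of index `-1` at infinity. -/
def RegularlyVaryingNegOne (g : ℝ → ℝ) : Prop :=
  ∀ c : ℝ, 0 < c → Tendsto (fun t => g (c * t) / g t) atTop (𝓝 c⁻¹)

variable (H : Type*) [NormedAddCommGroup H] [InnerProductSpace ℂ H] [CompleteSpace H]

/-- The ideal `L_g(H)`: the operators `X ∈ B(H)` with `sup_{t > 0} μ(t, X) / g(t) < ∞`. -/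
def idealL {g : ℝ → ℝ} (hg : IsGenerator g) : Submodule ℂ (H →L[ℂ] H) where
  carrier := {X | ∃ C : ℝ, ∀ t, 0 < t → singVal t X / g t ≤ C}
  zero_mem' := by
    refine ⟨0, fun t ht => ?_⟩
    have h : singVal t (0 : H →L[ℂ] H) ≤ 0 := by
      have : singVal t (0 : H →L[ℂ] H) ≤ ‖(0 : H →L[ℂ] H)‖ :=
        csInf_le (cutoffNorms_bddBelow _ _) (norm_mem_cutoffNorms ht.le _)
      rwa [norm_zero] at this
    exact div_nonpos_of_nonpos_of_nonneg h (hg.pos t ht).le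
  add_mem' := by
    rintro X Y ⟨A, hA⟩ ⟨B, hB⟩
    obtain ⟨C, hC⟩ := hg.doubling
    refine ⟨(A + B) * C, fun t ht => ?_⟩
    have ht2 : 0 < t / 2 := by positivity
    have h0 : singVal t (X + Y) ≤ singVal (t / 2) X + singVal (t / 2) Y := by
      have := singVal_add_le ht2.le ht2.le X Y
      rwa [add_halves] at this
    have hx := (div_le_iff₀ (hg.pos _ ht2)).1 (hA _ ht2)
    have hy := (div_le_iff₀ (hg.pos _ ht2)).1 (hB _ ht2)
    have hgt := hg.pos t ht
    have hd : g (t / 2) ≤ C * g t := by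
      have := hC _ ht2
      rw [mul_div_cancel₀ t two_ne_zero] at this
      exact (div_le_iff₀ hgt).1 this
    have hA0 : 0 ≤ A := (div_nonneg (singVal_nonneg t X) hgt.le).trans (hA t ht)
    have hB0 : 0 ≤ B := (div_nonneg (singVal_nonneg t Y) hgt.le).trans (hB t ht)
    rw [div_le_iff₀ hgt]
    calc singVal t (X + Y) ≤ (A + B) * g (t / 2) := by linarith
      _ ≤ (A + B) * (C * g t) := by gcongr
      _ = (A + B) * C * g t := by ring
  smul_mem' := by
    rintro c X ⟨A, hA⟩
    refine ⟨‖c‖ * A, fun t ht => ?_⟩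
    have hgt := hg.pos t ht
    have hx := (div_le_iff₀ hgt).1 (hA _ ht)
    rw [div_le_iff₀ hgt]
    calc singVal t (c • X) ≤ ‖c‖ * singVal t X := singVal_smul_le ht.le c X
      _ ≤ ‖c‖ * (A * g t) := by gcongr
      _ = ‖c‖ * A * g t := by ring

variable {H}

/-- A symmetric functional on `L_g(H)`: a linear functional that takes equal values on positive
operators with equal singular value functions. No continuity is required. -/
def IsSymmetricFunctional {g : ℝ → ℝ} {hg : IsGenerator g} (φ : idealL H hg →ₗ[ℂ] ℂ) : Prop :=
  ∀ X Y : idealL H hg, (X : H →L[ℂ] H).IsPositive → (Y : H →L[ℂ] H).IsPositive →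
    (∀ t : ℝ, 0 < t → singVal t (X : H →L[ℂ] H) = singVal t (Y : H →L[ℂ] H)) → φ X = φ Y

/-! ### Bounded sequences, extended limits, and the operators `C_g` and `Φ_g` -/

/-- The space of bounded complex sequences `(x_n)_{n ≥ 0}` with the supremum norm. -/
abbrev EllInfty : Type := lp (fun _ : ℕ => ℂ) ∞

/-- A sequence with a bound on its terms, as an element of `ℓ_∞`. -/
def mkBounded (x : ℕ → ℂ) (hx : ∃ C : ℝ, ∀ n, ‖x n‖ ≤ C) : EllInfty :=
  ⟨x, memℓp_infty (hx.imp fun _ hC => by rintro _ ⟨n, rfl⟩; exact hC n)⟩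

@[simp]
lemma mkBounded_apply (x : ℕ → ℂ) (hx : ∃ C : ℝ, ∀ n, ‖x n‖ ≤ C) (n : ℕ) :
    mkBounded x hx n = x n := rfl

/-- Extended limits: the bounded linear functionals on `ℓ_∞` that extend the ordinary limit. -/
def extendedLimits : Set (EllInfty →L[ℂ] ℂ) :=
  {ω | ∀ (x : EllInfty) (a : ℂ), Tendsto (fun n => x n) atTop (𝓝 a) → ω x = a}

/-- Extended limits that are nonnegative on nonnegative sequences. -/
def positiveExtendedLimits : Set (EllInfty →L[ℂ] ℂ) :=
  {ω | ω ∈ extendedLimits ∧ ∀ x : EllInfty, (∀ n, 0 ≤ x n) → 0 ≤ ω x}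

lemma rieszWeight_pos {g : ℝ → ℝ} (hg : IsGenerator g) (m : ℕ) :
    0 < (2 : ℝ) ^ m * g (2 ^ m) :=
  mul_pos (by positivity) (hg.pos _ (by positivity))

/-- The weighted Cesàro (Riesz) operator
`(C_g x)_n = (∑_{m=0}^n 2^m g(2^m) x_m) / (∑_{m=0}^n 2^m g(2^m))` on `ℓ_∞`. -/
def rieszOp {g : ℝ → ℝ} (hg : IsGenerator g) (x : EllInfty) : EllInfty :=
  mkBounded
    (fun n => (∑ m ∈ Finset.range (n + 1), (((2 : ℝ) ^ m * g (2 ^ m) : ℝ) : ℂ) * x m) /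
      ((∑ m ∈ Finset.range (n + 1), (2 : ℝ) ^ m * g (2 ^ m) : ℝ) : ℂ))
    (by
      refine ⟨‖x‖, fun n => ?_⟩
      have hpos : 0 < ∑ m ∈ Finset.range (n + 1), (2 : ℝ) ^ m * g (2 ^ m) :=
        Finset.sum_pos (fun m _ => rieszWeight_pos hg m) ⟨0, by simp⟩
      rw [norm_div, Complex.norm_real, Real.norm_of_nonneg hpos.le, div_le_iff₀ hpos,
        Finset.mul_sum]
      refine (norm_sum_le _ _).trans (Finset.sum_le_sum fun m _ => ?_)
      rw [norm_mul, Complex.norm_real, Real.norm_of_nonneg (rieszWeight_pos hg m).le, mul_comm]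
      exact mul_le_mul_of_nonneg_right (lp.norm_apply_le_norm ENNReal.top_ne_zero x m)
        (rieszWeight_pos hg m).le)

/-- The sequence `Φ_g(X)_n = (1 / (2^n g(2^n))) ∫_{2^n}^{2^{n+1}} μ(s, X) ds`, `n ≥ 0`. -/
def dyadicMean {g : ℝ → ℝ} (hg : IsGenerator g) (X : idealL H hg) : EllInfty :=
  mkBounded
    (fun n => ((1 / ((2 : ℝ) ^ n * g (2 ^ n)) *
      ∫ s in (2 : ℝ) ^ n..2 ^ (n + 1), singVal s (X : H →L[ℂ] H) : ℝ) : ℂ))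
    (by
      obtain ⟨C, hC⟩ := X.2
      refine ⟨C, fun n => ?_⟩
      have h2 : (0 : ℝ) < 2 ^ n := by positivity
      have hle : (2 : ℝ) ^ n ≤ 2 ^ (n + 1) := pow_le_pow_right₀ one_le_two (Nat.le_succ n)
      have hw := rieszWeight_pos hg n
      have hb : ‖∫ s in (2 : ℝ) ^ n..2 ^ (n + 1), singVal s (X : H →L[ℂ] H)‖ ≤
          (C * g (2 ^ n)) * |2 ^ (n + 1) - 2 ^ n| := by
        refine intervalIntegral.norm_integral_le_of_norm_le_const fun s hs => ?_
        rw [uIoc_of_le hle] at hs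
        rw [Real.norm_of_nonneg (singVal_nonneg _ _)]
        exact (singVal_antitoneOn _ h2.le (h2.le.trans hs.1.le) hs.1.le).trans
          ((div_le_iff₀ (hg.pos _ h2)).1 (hC _ h2))
      have hd : |(2 : ℝ) ^ (n + 1) - 2 ^ n| = 2 ^ n := by
        rw [abs_of_nonneg (by linarith)]; ring
      rw [hd] at hb
      rw [Complex.norm_real, norm_mul, Real.norm_of_nonneg (by positivity), one_div,
        inv_mul_le_iff₀ hw]
      linarith)

/-! ### Dixmier traces -/

/-- The primitive `G(t) = ∫_0^t g(s) ds`. -/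
def primitive (g : ℝ → ℝ) (t : ℝ) : ℝ := ∫ s in (0 : ℝ)..t, g s

lemma intervalIntegrable_generator {g : ℝ → ℝ} (hg : IsGenerator g)
    (hb : ∃ M : ℝ, ∀ t, 0 < t → g t ≤ M) {a b : ℝ} (ha : 0 ≤ a) (hab : a ≤ b) :
    IntervalIntegrable g volume a b := by
  obtain ⟨M, hM⟩ := hb
  rw [intervalIntegrable_iff_integrableOn_Ioc_of_le hab]
  have hsub : Ioc a b ⊆ Ioi 0 := fun s hs => lt_of_le_of_lt ha hs.1
  have : IsFiniteMeasure (volume.restrict (Ioc a b)) := inferInstance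
  refine Integrable.of_bound (aemeasurable_restrict_of_antitoneOn measurableSet_Ioc
    (hg.antitone.mono hsub)).aestronglyMeasurable M ?_
  refine (ae_restrict_iff' measurableSet_Ioc).2 (Eventually.of_forall fun s hs => ?_)
  rw [Real.norm_of_nonneg (hg.pos s (hsub hs)).le]
  exact hM s (hsub hs)

lemma sum_le_primitive {g : ℝ → ℝ} (hg : IsGenerator g)
    (hb : ∃ M : ℝ, ∀ t, 0 < t → g t ≤ M) (n : ℕ) :
    ∑ k ∈ Finset.range n, g (k + 1) ≤ primitive g n := by
  induction n with
  | zero => simp [primitive]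
  | succ n ih =>
    have hn : (0 : ℝ) ≤ n := Nat.cast_nonneg n
    have hint := intervalIntegrable_generator hg hb (a := n) (b := n + 1) hn (by linarith)
    have h1 : primitive g ((n + 1 : ℕ) : ℝ) = primitive g n + ∫ s in (n : ℝ)..(n + 1), g s := by
      unfold primitive
      rw [intervalIntegral.integral_add_adjacent_intervals
        (intervalIntegrable_generator hg hb le_rfl hn) hint]
      push_cast
      rfl
    have h2 : g (n + 1) ≤ ∫ s in (n : ℝ)..(n + 1), g s := by
      have := intervalIntegral.integral_mono_on_of_le_Ioo (a := (n : ℝ)) (b := n + 1)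
        (f := fun _ => g (n + 1)) (g := g) (μ := volume) (by linarith) (by simp) hint
        (fun s hs => hg.antitone (lt_of_le_of_lt hn hs.1) (by simp only [mem_Ioi]; linarith)
          hs.2.le)
      simpa using this
    rw [Finset.sum_range_succ, h1]
    exact add_le_add ih h2

/-- The sequence `n ↦ (∑_{k=0}^n μ(k, X)) / G(n)`. Its term at `n = 0`, where `G(0) = 0`, is `0`
by convention; extended limits do not depend on finitely many terms. -/
def dixmierSeq {g : ℝ → ℝ} (hg : IsGenerator g) (hb : ∃ M : ℝ, ∀ t, 0 < t → g t ≤ M)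
    (X : idealL H hg) : EllInfty :=
  mkBounded
    (fun n => (((∑ k ∈ Finset.range (n + 1), singVal k (X : H →L[ℂ] H)) /
      primitive g n : ℝ) : ℂ))
    (by
      obtain ⟨C, hC⟩ := X.2
      have hg1 := hg.pos 1 one_pos
      have hC0 : 0 ≤ C := (div_nonneg (singVal_nonneg 1 _) hg1.le).trans (hC 1 one_pos)
      set m0 := singVal 0 (X : H →L[ℂ] H) with hm0
      have hm0n : 0 ≤ m0 := singVal_nonneg _ _
      refine ⟨m0 / g 1 + C, fun n => ?_⟩
      rcases Nat.eq_zero_or_pos n with rfl | hn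
      · have : 0 ≤ m0 / g 1 + C := by positivity
        simpa [primitive] using this
      · set S := ∑ k ∈ Finset.range n, g (k + 1) with hS
        have hterm : ∀ k ∈ Finset.range n, 0 ≤ g ((k : ℝ) + 1) :=
          fun k _ => (hg.pos _ (by positivity)).le
        have hS1 : g 1 ≤ S := by
          have := Finset.single_le_sum hterm (Finset.mem_range.2 hn)
          simpa using this
        have hSG : S ≤ primitive g n := sum_le_primitive hg hb n
        have hG : 0 < primitive g n := hg1.trans_le (hS1.trans hSG)
        have hsum : ∑ k ∈ Finset.range (n + 1), singVal k (X : H →L[ℂ] H) ≤ C * S + m0 := by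
          rw [Finset.sum_range_succ', Nat.cast_zero, hS, Finset.mul_sum]
          gcongr with k hk
          have hk0 : (0 : ℝ) < (k : ℝ) + 1 := by positivity
          have := (div_le_iff₀ (hg.pos _ hk0)).1 (hC _ hk0)
          exact_mod_cast this
        have hm : m0 ≤ m0 / g 1 * S := by
          rw [div_mul_eq_mul_div, le_div_iff₀ hg1]
          gcongr
        have hk : 0 ≤ m0 / g 1 + C := by positivity
        rw [Complex.norm_real, Real.norm_of_nonneg (div_nonneg
          (Finset.sum_nonneg fun k _ => singVal_nonneg _ _) hG.le), div_le_iff₀ hG]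
        calc ∑ k ∈ Finset.range (n + 1), singVal k (X : H →L[ℂ] H) ≤ C * S + m0 := hsum
          _ ≤ (m0 / g 1 + C) * S := by linarith
          _ ≤ (m0 / g 1 + C) * primitive g n := by gcongr)

/-- `φ` is a Dixmier trace produced by some functional `ω` of the class `E`:
`φ(X) = log 2 · ω(n ↦ (∑_{k=0}^n μ(k, X)) / G(n))` for all positive `X`. The constant `log 2`
normalises `φ` to take the value `1` on the diagonal operator with entries `g(2^n)` repeated
`2^n` times. -/
def IsDixmierTrace {g : ℝ → ℝ} {hg : IsGenerator g} (hb : ∃ M : ℝ, ∀ t, 0 < t → g t ≤ M)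
    (E : Set (EllInfty →L[ℂ] ℂ)) (φ : idealL H hg →ₗ[ℂ] ℂ) : Prop :=
  IsSymmetricFunctional φ ∧ ∃ ω ∈ E, ∀ X : idealL H hg, (X : H →L[ℂ] H).IsPositive →
    φ X = (Real.log 2 : ℂ) * ω (dixmierSeq hg hb X)

end DixmierTheory

end

namespace DixmierTheory

/-! ### Asymptotics of the primitive of a regularly varying generator -/

section Generator

variable {g : ℝ → ℝ}

/-! Write `w_m = 2^m g(2^m)`, `W_n = ∑_{m<n} w_m`, `S_n = ∑_{k≤n} μ(k, X)` and `D_n = S_n / G(n)`.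
The weights in `C_g` cancel the normalisation in `Φ_g`, so the `n`-th term of `C_g(Φ_g(X))` is
exactly `(∫_1^{2^(n+1)} μ(s, X) ds) / W_{n+1}`. Replacing the integral by `S_{2^(n+1)}` costs a
bounded amount, negligible because `G → ∞`. Regular variation gives `∫_{2^m}^{2^(m+1)} g ~ log 2 ·
w_m`, and summing over blocks gives `G(2^n) / W_n → log 2`. Hence `log 2 · D_{2^(n+1)}` differs from
the weighted mean by a null sequence (`tendsto_log_two_mul_dixmierSeq_sub`), which explains the
factor `log 2`.

Conversely, `D` is determined up to a null sequence by its values at powers of two: within a dyadic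
block it changes by `O(w_k / G(2^k))`, and this tends to `0` (`tendsto_dixmierSeq_sub_reindex`).

Extended limits kill null sequences and, like the positive ones, are stable under composition with
any reindexing that tends to infinity. So `n ↦ 2^(n+1)` turns `γ` into `ω`, and `n ↦ log₂ n - 1`
turns `ω` into `γ`. -/

lemma primitive_add_integral (hg : IsGenerator g) (hb : ∃ M : ℝ, ∀ t, 0 < t → g t ≤ M)
    {a b : ℝ} (ha : 0 ≤ a) (hab : a ≤ b) :
    primitive g b = primitive g a + ∫ s in a..b, g s := by
  unfold primitive
  rw [intervalIntegral.integral_add_adjacent_intervals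
    (intervalIntegrable_generator hg hb le_rfl ha) (intervalIntegrable_generator hg hb ha hab)]

lemma integral_generator_nonneg (hg : IsGenerator g) {a b : ℝ} (ha : 0 ≤ a) (hab : a ≤ b) :
    0 ≤ ∫ s in a..b, g s := by
  rw [intervalIntegral.integral_of_le hab]
  exact setIntegral_nonneg measurableSet_Ioc fun s hs => (hg.pos s (ha.trans_lt hs.1)).le

lemma integral_generator_le (hg : IsGenerator g) (hb : ∃ M : ℝ, ∀ t, 0 < t → g t ≤ M)
    {a b : ℝ} (ha : 0 < a) (hab : a ≤ b) :
    ∫ s in a..b, g s ≤ (b - a) * g a := by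
  have h := intervalIntegral.integral_mono_on hab
    (intervalIntegrable_generator hg hb ha.le hab) (g := fun _ => g a) (by simp)
    (fun s hs => hg.antitone ha (ha.trans_le hs.1) hs.1)
  simpa using h

lemma primitive_mono (hg : IsGenerator g) (hb : ∃ M : ℝ, ∀ t, 0 < t → g t ≤ M)
    {a b : ℝ} (ha : 0 ≤ a) (hab : a ≤ b) : primitive g a ≤ primitive g b := by
  rw [primitive_add_integral hg hb ha hab]
  linarith [integral_generator_nonneg hg ha hab]

lemma primitive_pos (hg : IsGenerator g) (hb : ∃ M : ℝ, ∀ t, 0 < t → g t ≤ M)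
    {b : ℝ} (h : 0 < b) : 0 < primitive g b :=
  intervalIntegral.intervalIntegral_pos_of_pos_on
    (intervalIntegrable_generator hg hb le_rfl h.le) (fun s hs => hg.pos s hs.1) h

/-- A positive function whose primitive stays bounded would be integrable on the half-line. -/
lemma tendsto_primitive_atTop (hg : IsGenerator g) (hb : ∃ M : ℝ, ∀ t, 0 < t → g t ≤ M)
    (hni : ¬ IntegrableOn g (Ioi 0) volume) :
    Tendsto (fun n : ℕ => primitive g n) atTop atTop := by
  refine tendsto_atTop_atTop_of_monotone
    (fun m n h => primitive_mono hg hb (Nat.cast_nonneg _) (Nat.cast_le.2 h)) fun B => ?_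
  by_contra! hB
  refine hni (integrableOn_Ioi_of_intervalIntegral_norm_bounded (b := fun n : ℕ => (n : ℝ))
    (l := atTop) B 0 (fun n => ?_) tendsto_natCast_atTop_atTop (Eventually.of_forall fun n => ?_))
  · rw [← intervalIntegrable_iff_integrableOn_Ioc_of_le (Nat.cast_nonneg _)]
    exact intervalIntegrable_generator hg hb le_rfl (Nat.cast_nonneg _)
  · refine le_trans (le_of_eq ?_) (hB n).le
    refine intervalIntegral.integral_congr_ae (Eventually.of_forall fun s hs => ?_)
    rw [uIoc_of_le (Nat.cast_nonneg _)] at hs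
    exact Real.norm_of_nonneg (hg.pos s hs.1).le

lemma tendsto_primitive_two_pow (hg : IsGenerator g) (hb : ∃ M : ℝ, ∀ t, 0 < t → g t ≤ M)
    (hni : ¬ IntegrableOn g (Ioi 0) volume) :
    Tendsto (fun n : ℕ => primitive g (2 ^ n)) atTop atTop := by
  have h := (tendsto_primitive_atTop hg hb hni).comp
    (tendsto_pow_atTop_atTop_of_one_lt (r := 2) one_lt_two)
  simpa [Function.comp_def] using h

/-- The denominators `∑_{m < n} 2^m g(2^m)` of the weighted Cesàro operator. -/
def rieszSum (g : ℝ → ℝ) (n : ℕ) : ℝ := ∑ m ∈ Finset.range n, (2 : ℝ) ^ m * g (2 ^ m)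

/-- Since `g` decreases, its integral over the block starting at `2^m` is at most `w_m`. This
transfers the divergence of `G` to `rieszSum`. -/
lemma primitive_two_pow_le (hg : IsGenerator g) (hb : ∃ M : ℝ, ∀ t, 0 < t → g t ≤ M) (n : ℕ) :
    primitive g (2 ^ n) ≤ primitive g 1 + rieszSum g n := by
  induction n with
  | zero => simp [rieszSum]
  | succ n ih =>
    have h2 : (0 : ℝ) < 2 ^ n := by positivity
    have hle : (2 : ℝ) ^ n ≤ 2 ^ (n + 1) := pow_le_pow_right₀ one_le_two (Nat.le_succ n)
    have h := integral_generator_le hg hb h2 hle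
    rw [show (2 : ℝ) ^ (n + 1) - 2 ^ n = 2 ^ n by ring] at h
    rw [primitive_add_integral hg hb h2.le hle, rieszSum, Finset.sum_range_succ]
    rw [rieszSum] at ih
    linarith

lemma tendsto_rieszSum (hg : IsGenerator g) (hb : ∃ M : ℝ, ∀ t, 0 < t → g t ≤ M)
    (hni : ¬ IntegrableOn g (Ioi 0) volume) : Tendsto (rieszSum g) atTop atTop :=
  tendsto_atTop_mono (fun n => sub_le_iff_le_add'.2 (primitive_two_pow_le hg hb n))
    (tendsto_atTop_add_const_right _ (-primitive g 1) (tendsto_primitive_two_pow hg hb hni))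

/-- The integrand tends pointwise to `1/u` and is bounded by `1`, as `g` decreases and `u ≥ 1`;
dominated convergence yields `∫_1^2 du/u`. -/
lemma tendsto_integral_ratio (hg : IsGenerator g) (hrv : RegularlyVaryingNegOne g) :
    Tendsto (fun t => ∫ u in (1 : ℝ)..2, g (u * t) / g t) atTop (𝓝 (Real.log 2)) := by
  have hlog : Real.log 2 = ∫ u in (1 : ℝ)..2, u⁻¹ := by
    rw [integral_inv_of_pos one_pos two_pos, div_one]
  rw [hlog]
  refine intervalIntegral.tendsto_integral_filter_of_dominated_convergence (fun _ => 1) ?_ ?_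
    (by simp) ?_
  · filter_upwards [eventually_gt_atTop 0] with t ht
    rw [uIoc_of_le one_le_two]
    refine (aemeasurable_restrict_of_antitoneOn measurableSet_Ioc ?_).aestronglyMeasurable
    intro a ha b hb hab
    have ha0 : (0 : ℝ) < a := one_pos.trans ha.1
    have hb0 : (0 : ℝ) < b := one_pos.trans hb.1
    exact div_le_div_of_nonneg_right (hg.antitone (mul_pos ha0 ht) (mul_pos hb0 ht)
      (mul_le_mul_of_nonneg_right hab ht.le)) (hg.pos t ht).le
  · filter_upwards [eventually_gt_atTop 0] with t ht
    refine Eventually.of_forall fun u hu => ?_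
    rw [uIoc_of_le one_le_two] at hu
    have hu0 : (0 : ℝ) < u := one_pos.trans hu.1
    rw [Real.norm_of_nonneg (div_nonneg (hg.pos _ (mul_pos hu0 ht)).le (hg.pos t ht).le),
      div_le_one (hg.pos t ht)]
    exact hg.antitone ht (mul_pos hu0 ht) (le_mul_of_one_le_left ht.le hu.1.le)
  · refine Eventually.of_forall fun u hu => ?_
    rw [uIoc_of_le one_le_two] at hu
    exact hrv u (one_pos.trans hu.1)

lemma tendsto_two_pow_atTop : Tendsto (fun n : ℕ => (2 : ℝ) ^ n) atTop atTop :=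
  tendsto_pow_atTop_atTop_of_one_lt one_lt_two

lemma isLittleO_integral_dyadic (hg : IsGenerator g) (hrv : RegularlyVaryingNegOne g) :
    (fun m : ℕ => (∫ s in (2 : ℝ) ^ m..2 ^ (m + 1), g s) - Real.log 2 * (2 ^ m * g (2 ^ m)))
      =o[atTop] fun m : ℕ => (2 : ℝ) ^ m * g (2 ^ m) := by
  rw [Asymptotics.isLittleO_iff_tendsto fun m h => absurd h (rieszWeight_pos hg m).ne']
  have h := ((tendsto_integral_ratio hg hrv).comp tendsto_two_pow_atTop).sub_const (Real.log 2)
  rw [sub_self] at h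
  refine h.congr fun m => ?_
  have h2 : (0 : ℝ) < 2 ^ m := by positivity
  have hgm := hg.pos _ h2
  simp only [Function.comp_apply]
  -- The substitution `s = u · 2^m` carries `[1, 2]` to the dyadic block.
  rw [intervalIntegral.integral_div, intervalIntegral.integral_comp_mul_right _ h2.ne',
    one_mul, ← pow_succ', smul_eq_mul]
  field_simp

/-- The blockwise errors are `o(w_m)`, so by divergence of `∑ w_m` their sum is `o(W_n)`; the
leftover `G(1)` is negligible too. -/
lemma tendsto_primitive_div_rieszSum (hg : IsGenerator g)
    (hb : ∃ M : ℝ, ∀ t, 0 < t → g t ≤ M) (hrv : RegularlyVaryingNegOne g)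
    (hni : ¬ IntegrableOn g (Ioi 0) volume) :
    Tendsto (fun n : ℕ => primitive g (2 ^ n) / rieszSum g n) atTop (𝓝 (Real.log 2)) := by
  have hW := tendsto_rieszSum hg hb hni
  have h := ((isLittleO_integral_dyadic hg hrv).sum_range
    (fun m => (rieszWeight_pos hg m).le) hW).tendsto_div_nhds_zero
  have h1 := (hW.const_div_atTop (primitive g 1)).add (h.add_const (Real.log 2))
  rw [zero_add, zero_add] at h1
  refine h1.congr' ?_
  filter_upwards [hW.eventually_gt_atTop 0] with n hn
  have hsum : ∑ m ∈ Finset.range n, (∫ s in (2 : ℝ) ^ m..2 ^ (m + 1), g s) =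
      primitive g (2 ^ n) - primitive g 1 := by
    rw [Finset.sum_congr rfl fun m _ => eq_sub_of_add_eq' (primitive_add_integral hg hb
      (by positivity) (pow_le_pow_right₀ one_le_two (Nat.le_succ m))).symm,
      Finset.sum_range_sub (fun m : ℕ => primitive g (2 ^ m)), pow_zero]
  rw [Finset.sum_sub_distrib, hsum, ← Finset.mul_sum]
  change primitive g 1 / rieszSum g n +
    ((primitive g (2 ^ n) - primitive g 1 - Real.log 2 * rieszSum g n) / rieszSum g n +
      Real.log 2) = _
  field_simp
  ring

/-- Regular variation at `c = 2` makes the increments of `w` of order `o(w_m)`. They telescope to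
`w_n - w_0 = o(W_n)`, and `W_n` is comparable to `G(2^n)`. -/
lemma tendsto_weight_div_primitive (hg : IsGenerator g)
    (hb : ∃ M : ℝ, ∀ t, 0 < t → g t ≤ M) (hrv : RegularlyVaryingNegOne g)
    (hni : ¬ IntegrableOn g (Ioi 0) volume) :
    Tendsto (fun n : ℕ => (2 : ℝ) ^ n * g (2 ^ n) / primitive g (2 ^ n)) atTop (𝓝 0) := by
  have hW := tendsto_rieszSum hg hb hni
  have hstep : (fun m : ℕ => (2 : ℝ) ^ (m + 1) * g (2 ^ (m + 1)) - 2 ^ m * g (2 ^ m))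
      =o[atTop] fun m : ℕ => (2 : ℝ) ^ m * g (2 ^ m) := by
    rw [Asymptotics.isLittleO_iff_tendsto fun m h => absurd h (rieszWeight_pos hg m).ne']
    have h := (((hrv 2 two_pos).comp tendsto_two_pow_atTop).const_mul 2).sub_const 1
    rw [mul_inv_cancel₀ two_ne_zero, sub_self] at h
    refine h.congr fun m => ?_
    have hgm := hg.pos (2 ^ m) (by positivity)
    simp only [Function.comp_apply]
    rw [pow_succ']
    field_simp
  have h := (hstep.sum_range (fun m => (rieszWeight_pos hg m).le) hW).tendsto_div_nhds_zero
  have h1 : Tendsto (fun n : ℕ => (2 : ℝ) ^ n * g (2 ^ n) / rieszSum g n) atTop (𝓝 0) := by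
    have h2 := (hW.const_div_atTop (g 1)).add h
    rw [zero_add] at h2
    refine h2.congr fun n => ?_
    rw [Finset.sum_range_sub (fun m : ℕ => (2 : ℝ) ^ m * g (2 ^ m))]
    change g 1 / rieszSum g n + (_ - _) / rieszSum g n = _
    rw [← add_div]
    simp
  have h3 := h1.div (tendsto_primitive_div_rieszSum hg hb hrv hni)
    (Real.log_pos one_lt_two).ne'
  rw [zero_div] at h3
  refine h3.congr' ?_
  filter_upwards [hW.eventually_gt_atTop 0] with n hn
  have := primitive_pos hg hb (b := 2 ^ n) (by positivity)
  simp only [Pi.div_apply]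
  field_simp

end Generator

/-! ### Reindexing of bounded sequences and extended limits -/

section ExtendedLimits

/-- Composition with `u : ℕ → ℕ`, as a bounded operator on `ℓ_∞`. -/
noncomputable def reindex (u : ℕ → ℕ) : EllInfty →L[ℂ] EllInfty :=
  LinearMap.mkContinuous
    { toFun := fun x => mkBounded (fun n => x (u n))
        ⟨‖x‖, fun n => lp.norm_apply_le_norm ENNReal.top_ne_zero x (u n)⟩
      map_add' := fun _ _ => rfl
      map_smul' := fun _ _ => rfl }
    1 (fun x => by
      rw [one_mul]
      exact lp.norm_le_of_forall_le (norm_nonneg _)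
        fun n => lp.norm_apply_le_norm ENNReal.top_ne_zero x (u n))

@[simp]
lemma reindex_apply (u : ℕ → ℕ) (x : EllInfty) (n : ℕ) : reindex u x n = x (u n) := rfl

lemma comp_reindex_mem_extendedLimits {ω : EllInfty →L[ℂ] ℂ} (hω : ω ∈ extendedLimits)
    {u : ℕ → ℕ} (hu : Tendsto u atTop atTop) : ω.comp (reindex u) ∈ extendedLimits :=
  fun x a hx => hω (reindex u x) a (hx.comp hu)

lemma comp_reindex_mem_positiveExtendedLimits {ω : EllInfty →L[ℂ] ℂ}
    (hω : ω ∈ positiveExtendedLimits) {u : ℕ → ℕ} (hu : Tendsto u atTop atTop) :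
    ω.comp (reindex u) ∈ positiveExtendedLimits :=
  ⟨comp_reindex_mem_extendedLimits hω.1 hu, fun x hx => hω.2 (reindex u x) fun n => hx (u n)⟩

lemma extendedLimit_congr {ω : EllInfty →L[ℂ] ℂ} (hω : ω ∈ extendedLimits) {x y : EllInfty}
    (h : Tendsto (fun n => x n - y n) atTop (𝓝 0)) : ω x = ω y := by
  rw [← sub_eq_zero, ← map_sub]
  exact hω (x - y) 0 h

end ExtendedLimits

end DixmierTheory

namespace DixmierTheory

/-! ### Comparison of partial sums of singular values along dyadic integers -/

section PartialSums

variable {H : Type*} [NormedAddCommGroup H] [InnerProductSpace ℂ H] [CompleteSpace H]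

/-- The partial sums `∑_{k=0}^n μ(k, X)` of the singular values. -/
noncomputable def singValSum (X : H →L[ℂ] H) (n : ℕ) : ℝ :=
  ∑ k ∈ Finset.range (n + 1), singVal k X

lemma singValSum_nonneg (X : H →L[ℂ] H) (n : ℕ) : 0 ≤ singValSum X n :=
  Finset.sum_nonneg fun _ _ => singVal_nonneg _ _

lemma singVal_intervalIntegrable (X : H →L[ℂ] H) {a b : ℝ} (ha : 0 ≤ a) (hab : a ≤ b) :
    IntervalIntegrable (fun s => singVal s X) volume a b := by
  refine AntitoneOn.intervalIntegrable ((singVal_antitoneOn X).mono fun s hs => ?_)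
  rw [uIcc_of_le hab] at hs
  exact ha.trans hs.1

/-- Monotone sum-integral comparison on `[1, n]`: the difference lies between `0` and `μ(0, X) +
μ(1, X)`. -/
lemma abs_singValSum_sub_integral_le (X : H →L[ℂ] H) {n : ℕ} (hn : 1 ≤ n) :
    |singValSum X n - ∫ s in (1 : ℝ)..n, singVal s X| ≤ 2 * singVal 0 X := by
  have hanti : AntitoneOn (fun s => singVal s X) (Icc ((1 : ℕ) : ℝ) n) :=
    (singVal_antitoneOn X).mono fun s hs => (Nat.cast_nonneg 1).trans hs.1
  have hlow := AntitoneOn.sum_le_integral_Ico hn hanti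
  have hupp := AntitoneOn.integral_le_sum_Ico hn hanti
  rw [Nat.cast_one] at hlow hupp
  have h0 : singValSum X n =
      singVal 0 X + ∑ i ∈ Finset.Ico 1 n, singVal (i : ℝ) X + singVal n X := by
    rw [singValSum, Finset.sum_range_succ, ← Finset.sum_range_add_sum_Ico _ hn]
    simp
  have h1 : ∑ i ∈ Finset.Ico 1 n, singVal ((i + 1 : ℕ) : ℝ) X =
      ∑ i ∈ Finset.Ico 1 n, singVal (i : ℝ) X + singVal n X - singVal 1 X := by
    have h := Finset.sum_Ico_sub (fun i : ℕ => singVal (i : ℝ) X) hn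
    rw [Finset.sum_sub_distrib, Nat.cast_one] at h
    linarith
  have h2 := singVal_antitoneOn X (mem_Ici.2 le_rfl) (mem_Ici.2 zero_le_one) zero_le_one
  have h3 := singVal_nonneg 0 X
  have h4 := singVal_nonneg n X
  simp only at h2
  rw [abs_le]
  constructor <;> linarith

variable {g : ℝ → ℝ} {hg : IsGenerator g}

lemma rieszOp_dyadicMean_apply (X : idealL H hg) (n : ℕ) :
    rieszOp hg (dyadicMean hg X) n =
      (((∫ s in (1 : ℝ)..2 ^ (n + 1), singVal s (X : H →L[ℂ] H)) / rieszSum g (n + 1) : ℝ) :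
        ℂ) := by
  have hint := intervalIntegral.sum_integral_adjacent_intervals
    (f := fun s => singVal s (X : H →L[ℂ] H)) (μ := volume) (a := fun m : ℕ => (2 : ℝ) ^ m)
    (n := n + 1) fun k _ => singVal_intervalIntegrable _ (by positivity)
      (pow_le_pow_right₀ one_le_two (Nat.le_succ k))
  rw [pow_zero] at hint
  rw [← hint, rieszOp, mkBounded_apply, Complex.ofReal_div]
  refine congrArg₂ (· / ·) ?_ rfl
  rw [Complex.ofReal_sum]
  refine Finset.sum_congr rfl fun m _ => ?_
  rw [dyadicMean, mkBounded_apply, ← Complex.ofReal_mul, one_div,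
    mul_inv_cancel_left₀ (rieszWeight_pos hg m).ne']

variable (hb : ∃ M : ℝ, ∀ t, 0 < t → g t ≤ M)

lemma dixmierSeq_apply (X : idealL H hg) (n : ℕ) :
    dixmierSeq hg hb X n = ((singValSum (X : H →L[ℂ] H) n / primitive g n : ℝ) : ℂ) := rfl

/-- Along `2^(n+1)`, the normalised partial sums are asymptotic to the weighted Cesàro means. -/
lemma tendsto_log_two_mul_dixmierSeq_sub (hrv : RegularlyVaryingNegOne g)
    (hni : ¬ IntegrableOn g (Ioi 0) volume) (X : idealL H hg) :
    Tendsto (fun n => ((Real.log 2 : ℂ) • reindex (fun n => 2 ^ (n + 1)) (dixmierSeq hg hb X)) n -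
      rieszOp hg (dyadicMean hg X) n) atTop (𝓝 0) := by
  set μ : ℝ → ℝ := fun s => singVal s (X : H →L[ℂ] H) with hμ
  set S : ℕ → ℝ := fun n => singValSum (X : H →L[ℂ] H) (2 ^ (n + 1)) with hS
  set I : ℕ → ℝ := fun n => ∫ s in (1 : ℝ)..2 ^ (n + 1), μ s with hI
  set G : ℕ → ℝ := fun n => primitive g (2 ^ (n + 1)) with hG
  set W : ℕ → ℝ := fun n => rieszSum g (n + 1) with hW
  have hlog : 0 < Real.log 2 := Real.log_pos one_lt_two
  have hGpos : ∀ n, 0 < G n := fun n => primitive_pos hg hb (by positivity)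
  have hWpos : ∀ n, 0 < W n := fun n =>
    Finset.sum_pos (s := Finset.range (n + 1)) (fun m _ => rieszWeight_pos hg m) ⟨0, by simp⟩
  have hGtop : Tendsto G atTop atTop :=
    (tendsto_primitive_two_pow hg hb hni).comp (tendsto_add_atTop_nat 1)
  have hGW : Tendsto (fun n => G n / W n) atTop (𝓝 (Real.log 2)) :=
    (tendsto_primitive_div_rieszSum hg hb hrv hni).comp (tendsto_add_atTop_nat 1)
  have hSI : Tendsto (fun n => (S n - I n) / G n) atTop (𝓝 0) := by
    refine squeeze_zero_norm (fun n => ?_) (hGtop.const_div_atTop (2 * μ 0))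
    rw [norm_div, Real.norm_of_nonneg (hGpos n).le]
    refine div_le_div_of_nonneg_right ?_ (hGpos n).le
    have h := abs_singValSum_sub_integral_le (X : H →L[ℂ] H) (n := 2 ^ (n + 1)) Nat.one_le_two_pow
    push_cast at h
    exact h
  have hbdd : ∀ n, ‖I n / W n‖ ≤ ‖rieszOp hg (dyadicMean hg X)‖ := fun n => by
    rw [← Complex.norm_real, ← rieszOp_dyadicMean_apply]
    exact lp.norm_apply_le_norm ENNReal.top_ne_zero _ n
  have hfac : Tendsto (fun n => Real.log 2 / (G n / W n) - 1) atTop (𝓝 0) := by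
    have h := (tendsto_const_nhds (x := Real.log 2)).div hGW hlog.ne'
    rw [div_self hlog.ne'] at h
    simpa using h.sub_const 1
  -- With `L = log 2`, the difference splits as `L S/G - I/W = L (S - I)/G + (L/(G/W) - 1) (I/W)`;
  -- the last factor is bounded, being a term of an element of `ℓ_∞`.
  have hprod : Tendsto (fun n => (Real.log 2 / (G n / W n) - 1) * (I n / W n)) atTop (𝓝 0) :=
    hfac.zero_mul_isBoundedUnder_le (isBoundedUnder_of ⟨_, hbdd⟩)
  have hreal : Tendsto (fun n => Real.log 2 * (S n / G n) - I n / W n) atTop (𝓝 0) := by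
    have h := (hSI.const_mul (Real.log 2)).add hprod
    rw [mul_zero, zero_add] at h
    refine h.congr fun n => ?_
    have := (hGpos n).ne'
    have := (hWpos n).ne'
    field_simp
    ring
  have hc := (Complex.continuous_ofReal.tendsto 0).comp hreal
  rw [Complex.ofReal_zero] at hc
  refine hc.congr fun n => ?_
  rw [rieszOp_dyadicMean_apply, lp.coeFn_smul, Pi.smul_apply, reindex_apply, dixmierSeq_apply]
  simp [hS, hG, hI, hW, hμ]

/-! ### Slow variation within a dyadic block, and the equivalence. -/

lemma singValSum_sub_le {X : H →L[ℂ] H} {C : ℝ} {N n : ℕ}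
    (hC : singVal N X ≤ C) (hNn : N ≤ n) :
    singValSum X n - singValSum X N ≤ (n - N : ℝ) * C := by
  rw [singValSum, singValSum, ← Finset.sum_range_add_sum_Ico _ (Nat.succ_le_succ hNn),
    add_sub_cancel_left]
  have h := Finset.sum_le_card_nsmul (Finset.Ico (N + 1) (n + 1)) (fun k : ℕ => singVal k X) C
    fun k hk => by
      have hNk : N ≤ k := (Nat.le_succ N).trans (Finset.mem_Ico.1 hk).1
      exact (singVal_antitoneOn X (mem_Ici.2 (Nat.cast_nonneg N)) (mem_Ici.2 (Nat.cast_nonneg k))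
        (Nat.cast_le.2 hNk)).trans hC
  rw [Nat.card_Ico, Nat.add_sub_add_right, nsmul_eq_mul, Nat.cast_sub hNn] at h
  exact h

lemma singValSum_mono (X : H →L[ℂ] H) : Monotone (singValSum X) := fun _ _ h =>
  Finset.sum_le_sum_of_subset_of_nonneg (Finset.range_mono (Nat.succ_le_succ h))
    fun _ _ _ => singVal_nonneg _ _

/-- Growth of the numerator raises the quotient by at most `C w / G`; growth of the denominator
lowers it by at most `M w / G`. -/
lemma abs_div_sub_div_le {s s' G G' w C M : ℝ} (hG : 0 < G) (hs : 0 ≤ s) (hM : s / G ≤ M)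
    (hC : 0 ≤ C) (hss : s ≤ s') (hs' : s' - s ≤ C * w) (hGG : G ≤ G') (hG' : G' - G ≤ w) :
    |s' / G' - s / G| ≤ (C + M) * (w / G) := by
  have hw : 0 ≤ w := by linarith
  have hG0 : 0 < G' := hG.trans_le hGG
  have hM0 : 0 ≤ s / G := div_nonneg hs hG.le
  have hwG : 0 ≤ w / G := div_nonneg hw hG.le
  have hCw := mul_nonneg hC hwG
  have hMw := mul_nonneg (hM0.trans hM) hwG
  rw [abs_le]
  constructor
  · have h1 : s / G' ≤ s' / G' := div_le_div_of_nonneg_right hss hG0.le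
    have h2 : s / G - s / G' = s / G * ((G' - G) / G') := by field_simp
    have h3 : (G' - G) / G' ≤ w / G := div_le_div₀ hw hG' hG hGG
    have h4 : s / G * ((G' - G) / G') ≤ M * (w / G) :=
      mul_le_mul hM h3 (div_nonneg (by linarith) hG0.le) (hM0.trans hM)
    linarith
  · have h1 : s' / G' ≤ s' / G := div_le_div_of_nonneg_left (hs.trans hss) hG hGG
    have h2 : s' / G - s / G ≤ C * (w / G) := by
      rw [← sub_div, ← mul_div_assoc]
      exact div_le_div_of_nonneg_right hs' hG.le
    linarith

lemma tendsto_log_two_atTop : Tendsto (Nat.log 2) atTop atTop :=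
  tendsto_atTop_atTop_of_monotone Nat.log_monotone
    fun b => ⟨2 ^ b, (Nat.log_pow one_lt_two b).ge⟩

/-- The normalised partial sums vary slowly: they may be sampled at powers of two. -/
lemma tendsto_dixmierSeq_sub_reindex (hrv : RegularlyVaryingNegOne g)
    (hni : ¬ IntegrableOn g (Ioi 0) volume) (X : idealL H hg) :
    Tendsto (fun n => dixmierSeq hg hb X n - reindex (fun n => Nat.log 2 n - 1)
      (reindex (fun n => 2 ^ (n + 1)) (dixmierSeq hg hb X)) n) atTop (𝓝 0) := by
  obtain ⟨C, hC⟩ := X.2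
  have hC0 : 0 ≤ C := (div_nonneg (singVal_nonneg 1 _) (hg.pos 1 one_pos).le).trans (hC 1 one_pos)
  have hlim := ((tendsto_weight_div_primitive hg hb hrv hni).comp tendsto_log_two_atTop).const_mul
    (C + ‖dixmierSeq hg hb X‖)
  rw [mul_zero] at hlim
  refine squeeze_zero_norm' ?_ hlim
  -- For `n ≥ 2` the truncated subtraction is genuine, so the two reindexings sample at `2^(log₂
  -- n)`, the left end of the block containing `n`.
  filter_upwards [eventually_ge_atTop 2] with n hn
  have hlog1 : 1 ≤ Nat.log 2 n := Nat.log_pos one_lt_two hn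
  have hle : 2 ^ Nat.log 2 n ≤ n := Nat.pow_log_le_self 2 (by omega)
  have hlt : n < 2 ^ (Nat.log 2 n + 1) := Nat.lt_pow_succ_log_self one_lt_two n
  simp only [reindex_apply, Nat.sub_add_cancel hlog1, Function.comp_apply]
  generalize Nat.log 2 n = k at hle hlt
  have hN : (0 : ℝ) < 2 ^ k := by positivity
  have hle' : (2 : ℝ) ^ k ≤ n := by exact_mod_cast hle
  have hdiff : (n : ℝ) - 2 ^ k ≤ 2 ^ k := by
    have : (n : ℝ) < 2 ^ (k + 1) := by exact_mod_cast hlt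
    rw [pow_succ] at this
    linarith
  have hgN := hg.pos _ hN
  have hbound : singValSum (X : H →L[ℂ] H) (2 ^ k) / primitive g (2 ^ k) ≤
      ‖dixmierSeq hg hb X‖ := by
    have h := lp.norm_apply_le_norm ENNReal.top_ne_zero (dixmierSeq hg hb X) (2 ^ k)
    rw [dixmierSeq_apply, Complex.norm_real] at h
    push_cast at h
    exact (Real.le_norm_self _).trans h
  rw [dixmierSeq_apply, dixmierSeq_apply, ← Complex.ofReal_sub, Complex.norm_real]
  push_cast
  refine abs_div_sub_div_le (primitive_pos hg hb hN) (singValSum_nonneg _ _) hbound hC0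
    (singValSum_mono _ hle) ?_ (primitive_mono hg hb hN.le hle') ?_
  · have h := singValSum_sub_le (X := (X : H →L[ℂ] H)) (C := C * g (2 ^ k)) (N := 2 ^ k) (n := n)
      (by push_cast; exact (div_le_iff₀ hgN).1 (hC _ hN)) hle
    push_cast at h
    refine h.trans ?_
    calc ((n : ℝ) - 2 ^ k) * (C * g (2 ^ k)) ≤ 2 ^ k * (C * g (2 ^ k)) := by gcongr
      _ = C * (2 ^ k * g (2 ^ k)) := by ring
  · rw [primitive_add_integral hg hb hN.le hle', add_sub_cancel_left]
    exact (integral_generator_le hg hb hN hle').trans (mul_le_mul_of_nonneg_right hdiff hgN.le)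

/-- The equivalence for any class of extended limits that is stable under reindexing. -/
lemma isDixmierTrace_iff {E : Set (EllInfty →L[ℂ] ℂ)} (hE : E ⊆ extendedLimits)
    (hEu : ∀ ω ∈ E, ∀ u : ℕ → ℕ, Tendsto u atTop atTop → ω.comp (reindex u) ∈ E)
    (hrv : RegularlyVaryingNegOne g) (hni : ¬ IntegrableOn g (Ioi 0) volume)
    {φ : idealL H hg →ₗ[ℂ] ℂ} (hφ : IsSymmetricFunctional φ) :
    IsDixmierTrace hb E φ ↔ ∃ γ ∈ E, ∀ X : idealL H hg, (X : H →L[ℂ] H).IsPositive →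
      φ X = γ (rieszOp hg (dyadicMean hg X)) := by
  have hpow : Tendsto (fun n : ℕ => 2 ^ (n + 1)) atTop atTop :=
    (tendsto_pow_atTop_atTop_of_one_lt one_lt_two).comp (tendsto_add_atTop_nat 1)
  have hlog : Tendsto (fun n => Nat.log 2 n - 1) atTop atTop :=
    (tendsto_sub_atTop_nat 1).comp tendsto_log_two_atTop
  -- This holds for every `X` and every `γ` in the class; both directions then only choose a
  -- reindexing.
  have hriesz : ∀ γ ∈ E, ∀ X : idealL H hg, γ (rieszOp hg (dyadicMean hg X)) =
      (Real.log 2 : ℂ) * γ (reindex (fun n => 2 ^ (n + 1)) (dixmierSeq hg hb X)) := by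
    intro γ hγ X
    rw [← smul_eq_mul, ← map_smul]
    exact (extendedLimit_congr (hE hγ) (tendsto_log_two_mul_dixmierSeq_sub hb hrv hni X)).symm
  constructor
  · rintro ⟨-, ω, hω, h⟩
    refine ⟨_, hEu ω hω _ hlog, fun X hX => ?_⟩
    rw [hriesz _ (hEu ω hω _ hlog), h X hX,
      extendedLimit_congr (hE hω) (tendsto_dixmierSeq_sub_reindex hb hrv hni X)]
    rfl
  · rintro ⟨γ, hγ, h⟩
    refine ⟨hφ, _, hEu γ hγ _ hpow, fun X hX => ?_⟩
    rw [h X hX, hriesz γ hγ]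
    rfl

end PartialSums

end DixmierTheory

theorem theorem4p5 {H : Type*} [NormedAddCommGroup H] [InnerProductSpace ℂ H] [CompleteSpace H]
    [TopologicalSpace.SeparableSpace H]
    (g : ℝ → ℝ) (hg : DixmierTheory.IsGenerator g)
    (hb : ∃ M : ℝ, ∀ t, 0 < t → g t ≤ M)
    (hrv : DixmierTheory.RegularlyVaryingNegOne g)
    (hni : ¬ IntegrableOn g (Ioi 0) volume)
    (φ : DixmierTheory.idealL H hg →ₗ[ℂ] ℂ) (hφ : DixmierTheory.IsSymmetricFunctional φ) :
    (DixmierTheory.IsDixmierTrace hb DixmierTheory.extendedLimits φ ↔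
      ∃ γ ∈ DixmierTheory.extendedLimits, ∀ X : DixmierTheory.idealL H hg,
        (X : H →L[ℂ] H).IsPositive →
          φ X = γ (DixmierTheory.rieszOp hg (DixmierTheory.dyadicMean hg X))) ∧
    (DixmierTheory.IsDixmierTrace hb DixmierTheory.positiveExtendedLimits φ ↔
      ∃ γ ∈ DixmierTheory.positiveExtendedLimits, ∀ X : DixmierTheory.idealL H hg,
        (X : H →L[ℂ] H).IsPositive →
          φ X = γ (DixmierTheory.rieszOp hg (DixmierTheory.dyadicMean hg X))) := by
  exact
    ⟨DixmierTheory.isDixmierTrace_iff hb subset_rfl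
      (fun _ hω _ hu => DixmierTheory.comp_reindex_mem_extendedLimits hω hu) hrv hni hφ,
    DixmierTheory.isDixmierTrace_iff hb (fun _ hω => hω.1)
      (fun _ hω _ hu => DixmierTheory.comp_reindex_mem_positiveExtendedLimits hω hu) hrv hni hφ⟩
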